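/- Setting. Let $K\ge 2$, and let $\nu_1,\dots,\nu_K$ be probability distributions on $[0,1]$ whose means satisfy $0<\mu_K\le\cdots\le\mu_2<\mu_1<1$; put $\Delta_k=\mu_1-\mu_k$. For each arm $k$ let $X_{k,1},X_{k,2},\dots$ be i.i.d. with law $\nu_k$. At each time $t=1,2,\dots$ a leader broadcasts an arm $A_t\in\{1,\dots,K\}$, which is a function of the one-bit messages received so far; the follower at arm $A_t$ pulls it for the $s$-th time, where $s=T_{A_t}(t)$ and $T_k(t)$ is the number of broadcasts of $k$ up to time $t$, observes $X_{A_t,s}$, and sends a bit $M_{A_t,s}$ to the leader. The regret is $R_n=\sum_{t=1}^n\mathbb E[\mu_1-\mu_{A_t}]$. Message policy $\pi^m$. For integers $i,s,\alpha\ge0$ let $\tau(i)=1+(i+1)\lceil\log_2(i+1)\rceil-2^{\lceil\log_2(i+1)\rceil}$, $\iota(s)=\max\{i\ge 0:\tau(i)\le s\}$, $\Gamma_\alpha(x)=\lceil 2^\alpha x\rceil-1$ for $x\in(0,1]$, $\Gamma_\alpha(0)=0$, and let $\hat\mu_{k,m}$ be the average of $X_{k,1},\dots,X_{k,m}$. With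 $b=\tau(\iota(s-1))$, the $s$-th message of arm $k$ is $M_{k,s}=\Gamma_{s-b}(\hat\mu_{k,1+b})-2\,\Gamma_{s-b-1}(\hat\mu_{k,1+b})\in\{0,1\}$. UCB1 arm policy $\pi^a(g^{\mathrm{UCB1}})$. For $s\ge1$ put $\eta(s)=1+\tau(\iota(s)-1)$ and $$\bar\mu_{k,s}=\sum_{s'=1+\tau(\iota(s)-1)}^{\tau(\iota(s))}2^{\tau(\iota(s)-1)-s'}M_{k,s'}+2^{\tau(\iota(s)-1)-\tau(\iota(s))}.$$ Then $A_t=t$ for $t\le K$, and for $t>K$ the arm $A_t$ is a maximizer over $k$ of $g_t(\bar\mu_{k,T_k(t-1)},\eta(T_k(t-1)))$, where $g_t(x,s)=x+\sqrt{2\log(t)/s}$ (ties are broken by an arbitrary rule depending on $t$ and the messages received). Claim. For $n\ge2$ let $C_n=2+(\log n)^{1/3}$. Then $R_n\le\min\{B^{(1)}_n,B^{(2)}_n\}$, where $$B^{(1)}_n=\sum_{k=2}^K\left(\frac{8\log n}{\Delta_k}+\frac{160}{\Delta_k}+\frac{19\Delta_k}{6}\log_2\max\left\{\left\lceil\frac{8\log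 n}{\Delta_k^2}\right\rceil,\frac{64}{\Delta_k^2}\right\}\right),$$ $$B^{(2)}_n=\sum_{k=2}^K\left(\frac{2\log n}{\Delta_k}+\frac{8(1-\frac1{C_n})\log n}{\Delta_k(1-\frac2{C_n})^2C_n}+\frac{10C_n^2}{\Delta_k}+\frac{13\Delta_k}{4}\log_2\max\left\{\left\lceil\frac{2\log n}{\Delta_k^2(1-\frac2{C_n})^2}\right\rceil,\frac{4C_n^2}{\Delta_k^2}\right\}\right).$$ Moreover $$B^{(1)}_n=\sum_{k=2}^K\frac{8\log n}{\Delta_k}+O\!\left(\frac{K\log\log n}{\Delta_2}\right)\ (n\ge3),\qquad B^{(2)}_n=\sum_{k=2}^K\frac{2\log n}{\Delta_k}+O\!\left(\frac{K(\log n)^{2/3}}{\Delta_2}\right)\ (n\ge2),$$ where the constants implied by $O(\cdot)$ are universal (independent of $n$, $K$ and the distributions). -/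

import Mathlib

open MeasureTheory ProbabilityTheory

namespace OneBitBandit

/-! ### The leader-follower game

Arms are indexed by `Fin K`, so that the arms `1, …, K` of the usual numbering are
`0, …, K - 1` here; times `t` start at `1`. -/

/-- A message policy `π^m`: at time `t` the follower of the broadcast arm maps the list of all
rewards of its arm observed so far (oldest first, including the one just observed) to one bit. -/
abbrev MessagePolicy : Type := ℕ → List ℝ → Bool

/-- An arm policy `π^a`: at time `t` the leader maps the messages received so far, given as one
list for each arm (oldest first), to the arm to broadcast. -/
abbrev ArmPolicy (K : ℕ) : Type := ℕ → (Fin K → List Bool) → Fin K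

/-- The messages that the leader has received from each arm up to and including time `t`, where
`x k i` is the reward of the `(i + 1)`-st pull of arm `k`. -/
def messages {K : ℕ} (πa : ArmPolicy K) (πm : MessagePolicy) (x : Fin K → ℕ → ℝ) :
    ℕ → Fin K → List Bool
  | 0 => fun _ => []
  | t + 1 =>
    let h := messages πa πm x t
    let a := πa (t + 1) h
    Function.update h a
      (h a ++ [πm (t + 1) ((List.range ((h a).length + 1)).map (x a))])

/-- The arm `A_t` broadcast at time `t ≥ 1`. -/
def arm {K : ℕ} (πa : ArmPolicy K) (πm : MessagePolicy) (x : Fin K → ℕ → ℝ) (t : ℕ) : Fin K :=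
  πa t (messages πa πm x (t - 1))

/-- The expected reward `μ_k` of each arm, for the reward distributions `ν`. -/
noncomputable def armMean {K : ℕ} (ν : Fin K → Measure ℝ) (k : Fin K) : ℝ := ∫ y, y ∂(ν k)

/-- The arm means are sorted, with a unique best arm, and are nondegenerate:
`0 < μ_K ≤ ⋯ ≤ μ_2 < μ_1 < 1`. -/
structure SortedMeans {K : ℕ} [NeZero K] (μ : Fin K → ℝ) : Prop where
  pos : ∀ k, 0 < μ k
  lt_one : ∀ k, μ k < 1
  antitone : Antitone μ
  unique_best : ∀ k, k ≠ 0 → μ k < μ 0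

/-- `X k i` is the reward of the `(i + 1)`-st pull of arm `k`: for each `k` these are i.i.d. with
law `ν k`, a probability distribution on `[0, 1]`. -/
structure IsRewardModel {K : ℕ} {Ω : Type*} [MeasurableSpace Ω] (P : Measure Ω)
    (ν : Fin K → Measure ℝ) (X : Fin K → ℕ → Ω → ℝ) : Prop where
  prob : ∀ k, IsProbabilityMeasure (ν k)
  support : ∀ k, ν k (Set.Icc 0 1)ᶜ = 0
  measurable : ∀ k i, Measurable (X k i)
  law : ∀ k i, P.map (X k i) = ν k
  indep : ∀ k, iIndepFun (X k) P

/-- The regret `R_n(π^a, π^m) = ∑_{t = 1}^n E[max_k μ_k - μ_{A_t}]`. -/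
noncomputable def regret {K : ℕ} {Ω : Type*} [MeasurableSpace Ω] (P : Measure Ω)
    (ν : Fin K → Measure ℝ) (X : Fin K → ℕ → Ω → ℝ)
    (πa : ArmPolicy K) (πm : MessagePolicy) (n : ℕ) : ℝ :=
  ∑ t ∈ Finset.Icc 1 n,
    ∫ ω, ((⨆ k, armMean ν k) - armMean ν (arm πa πm (fun k i => X k i ω) t)) ∂P

/-! ### The message policy -/

/-- `τ(i) = 1 + (i + 1) ⌈log₂ (i + 1)⌉ - 2 ^ ⌈log₂ (i + 1)⌉`: the number of pulls at which the
`i`-th packet completes transmission. The subtraction never truncates. -/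
def tau (i : ℕ) : ℕ := 1 + (i + 1) * Nat.clog 2 (i + 1) - 2 ^ Nat.clog 2 (i + 1)

/-- `ι(s) = max {i | τ(i) ≤ s}`: the number of packets transmitted after `s` pulls. -/
def iota (s : ℕ) : ℕ := Nat.findGreatest (fun i => tau i ≤ s) s

theorem two_pow_clog_le (i : ℕ) :
    2 ^ Nat.clog 2 (i + 1) + i ≤ 1 + (i + 1) * Nat.clog 2 (i + 1) := by
  rcases Nat.eq_zero_or_pos i with rfl | hi
  · simp
  · have h1 : 1 < i + 1 := by omega
    have hlt := Nat.pow_pred_clog_lt_self (b := 2) (by norm_num) h1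
    have hpos : 0 < Nat.clog 2 (i + 1) := Nat.clog_pos (by norm_num) (by omega)
    obtain ⟨c, hc⟩ : ∃ c, Nat.clog 2 (i + 1) = c + 1 := ⟨_, (Nat.succ_pred_eq_of_pos hpos).symm⟩
    rw [hc] at hlt ⊢
    simp only [Nat.pred_eq_sub_one, Nat.add_sub_cancel] at hlt
    rcases Nat.eq_zero_or_pos c with rfl | hc0
    · have hle := Nat.le_pow_clog (b := 2) (by norm_num) (i + 1)
      rw [hc] at hle
      norm_num at hle ⊢
      omega
    · rw [pow_succ]
      rcases Nat.lt_or_ge c 2 with h2 | h2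
      · obtain rfl : c = 1 := by omega
        norm_num at hlt ⊢
        omega
      · have h3 : (i + 1) * 3 ≤ (i + 1) * (c + 1) := Nat.mul_le_mul_left _ (by omega)
        omega

theorem le_tau (i : ℕ) : i ≤ tau i := by
  have h := two_pow_clog_le i
  unfold tau
  omega

theorem isGreatest_iota (s : ℕ) : IsGreatest {i | tau i ≤ s} (iota s) := by
  refine ⟨?_, fun i hi => ?_⟩
  · exact Nat.findGreatest_spec (P := fun i => tau i ≤ s) (Nat.zero_le s) (by simp [tau])
  · exact Nat.le_findGreatest ((le_tau i).trans hi) hi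

/-- The quantizer `Γ_α(x) = ⌈2 ^ α x⌉ - 1` for `x ≠ 0`, and `Γ_α(0) = 0`. -/
noncomputable def quantizer (α : ℕ) (x : ℝ) : ℤ := if x = 0 then 0 else ⌈2 ^ α * x⌉ - 1

/-- The empirical mean of the first `m` entries of a list of rewards. -/
noncomputable def empMean (l : List ℝ) (m : ℕ) : ℝ := (l.take m).sum / m

/-- With `s` rewards `l` observed at the arm, the number
`Γ_{s - τ(ι(s-1))}(μ̂) - 2 Γ_{s - τ(ι(s-1)) - 1}(μ̂)`, where `μ̂` is the empirical mean of
the first `1 + τ(ι(s-1))` rewards. -/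
noncomputable def messageValue (l : List ℝ) : ℤ :=
  let b := tau (iota (l.length - 1))
  quantizer (l.length - b) (empMean l (1 + b)) - 2 * quantizer (l.length - b - 1) (empMean l (1 + b))

/-- The message policy `π^m`: the follower transmits the bit `messageValue`. -/
noncomputable def messagePolicy : MessagePolicy := fun _ l => decide (messageValue l = 1)

theorem quantizer_succ (α : ℕ) (x : ℝ) :
    quantizer (α + 1) x - 2 * quantizer α x = 0 ∨ quantizer (α + 1) x - 2 * quantizer α x = 1 := by
  unfold quantizer
  split_ifs with hx
  · simp
  · have h1 := Int.le_ceil ((2 : ℝ) ^ α * x)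
    have h2 := Int.ceil_lt_add_one ((2 : ℝ) ^ α * x)
    have h3 := Int.le_ceil ((2 : ℝ) ^ (α + 1) * x)
    have h4 := Int.ceil_lt_add_one ((2 : ℝ) ^ (α + 1) * x)
    have e : (2 : ℝ) ^ (α + 1) * x = 2 * ((2 : ℝ) ^ α * x) := by ring
    rw [e] at h3 h4 ⊢
    have h5 : ⌈2 * ((2 : ℝ) ^ α * x)⌉ ≤ 2 * ⌈(2 : ℝ) ^ α * x⌉ := by
      apply Int.ceil_le.mpr
      push_cast
      linarith
    have h6 : 2 * ⌈(2 : ℝ) ^ α * x⌉ < ⌈2 * ((2 : ℝ) ^ α * x)⌉ + 2 := by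
      have : (2 : ℝ) * ⌈(2 : ℝ) ^ α * x⌉ < ⌈2 * ((2 : ℝ) ^ α * x)⌉ + 2 := by linarith
      exact_mod_cast this
    omega

/-- `messageValue` is binary, so that the transmitted bit is exactly this number. -/
theorem messagePolicy_toNat (t : ℕ) (l : List ℝ) (hl : l ≠ []) :
    ((messagePolicy t l).toNat : ℤ) = messageValue l := by
  have hpos : 0 < l.length := List.length_pos_iff.mpr hl
  have hb : tau (iota (l.length - 1)) ≤ l.length - 1 := (isGreatest_iota (l.length - 1)).1
  have key : messageValue l = 0 ∨ messageValue l = 1 := by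
    have h := quantizer_succ (l.length - tau (iota (l.length - 1)) - 1)
      (empMean l (1 + tau (iota (l.length - 1))))
    have e : l.length - tau (iota (l.length - 1)) - 1 + 1
        = l.length - tau (iota (l.length - 1)) := by omega
    rw [e] at h
    exact h
  rcases key with h | h <;> simp [messagePolicy, h]

/-! ### The arm policies -/

/-- `η(s) = 1 + τ(ι(s) - 1)`: the number of samples of the estimate carried by the most recent
complete packet after `s ≥ 1` pulls. -/
def eta (s : ℕ) : ℕ := 1 + tau (iota s - 1)

/-- The leader's estimate
`μ̄_s = ∑_{s' = 1 + τ(ι(s)-1)}^{τ(ι(s))} 2 ^ (τ(ι(s)-1) - s') M_{s'} + 2 ^ (τ(ι(s)-1) - τ(ι(s)))`,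
computed from the list `l` of the first `s` messages (`M_{s'}` is entry `s' - 1` of `l`). -/
noncomputable def decode (l : List Bool) : ℝ :=
  let a := tau (iota l.length - 1)
  let b := tau (iota l.length)
  ∑ s' ∈ Finset.Icc (1 + a) b,
      (2 : ℝ) ^ ((a : ℤ) - (s' : ℤ)) * ((l.getD (s' - 1) false).toNat : ℝ)
    + (2 : ℝ) ^ ((a : ℤ) - (b : ℤ))

/-- `πa` is the arm policy `π^a(g)` for the decision functions `g_t(x, s)`, with some rule for
breaking ties: arms `1, …, K` are broadcast in turn at times `1, …, K`, and at each time `t > K`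
the broadcast arm maximizes `g_t(μ̄_{k, T_k(t-1)}, η(T_k(t-1)))`. The number `T_k(t-1)` of earlier
broadcasts of `k` is the number of messages received from `k`. -/
structure IsArmPolicy {K : ℕ} (g : ℕ → ℝ → ℕ → ℝ) (πa : ArmPolicy K) : Prop where
  round_robin : ∀ (t : ℕ) (h : Fin K → List Bool), 1 ≤ t → t ≤ K → (πa t h : ℕ) + 1 = t
  argmax : ∀ (t : ℕ) (h : Fin K → List Bool), K < t → ∀ k : Fin K,
    g t (decode (h k)) (eta (h k).length)
      ≤ g t (decode (h (πa t h))) (eta (h (πa t h)).length)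

/-- The `UCB1` decision functions `g_t(x, s) = x + √(2 log t / s)`. -/
noncomputable def gUCB1 (t : ℕ) (x : ℝ) (s : ℕ) : ℝ := x + √(2 * Real.log t / s)

/-! ### The bounds -/

/-- The gap `Δ_k = μ_1 - μ_k`. -/
def gap {K : ℕ} [NeZero K] (μ : Fin K → ℝ) (k : Fin K) : ℝ := μ 0 - μ k

/-- `C_n = 2 + (log n) ^ (1/3)`. -/
noncomputable def Cn (n : ℕ) : ℝ := 2 + Real.log n ^ (1 / 3 : ℝ)

/-- The first finite-horizon bound; the sum is over all arms but the first. -/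
noncomputable def bound₁ {K : ℕ} [NeZero K] (μ : Fin K → ℝ) (n : ℕ) : ℝ :=
  ∑ k ∈ Finset.Ioi (0 : Fin K),
    (8 * Real.log n / gap μ k + 160 / gap μ k
      + 19 * gap μ k / 6 *
        Real.logb 2 (max (⌈8 * Real.log n / gap μ k ^ 2⌉ : ℝ) (64 / gap μ k ^ 2)))

/-- The second finite-horizon bound. -/
noncomputable def bound₂ {K : ℕ} [NeZero K] (μ : Fin K → ℝ) (n : ℕ) : ℝ :=
  ∑ k ∈ Finset.Ioi (0 : Fin K),
    (2 * Real.log n / gap μ k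
      + 8 * (1 - 1 / Cn n) * Real.log n / (gap μ k * (1 - 2 / Cn n) ^ 2 * Cn n)
      + 10 * Cn n ^ 2 / gap μ k
      + 13 * gap μ k / 4 *
        Real.logb 2 (max (⌈2 * Real.log n / (gap μ k ^ 2 * (1 - 2 / Cn n) ^ 2)⌉ : ℝ)
          (4 * Cn n ^ 2 / gap μ k ^ 2)))

end OneBitBandit

open OneBitBandit

namespace OneBitBandit

/-! ### Packet lengths -/

/-! The messages of an arm come in packets. Packet `i + 1` has `Nat.clog 2 (i + 2)` bits
(`tau_succ`), and they are the binary digits of the mean of the first `1 + tau i` rewards. After `s`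
pulls the leader therefore knows the mean of `eta s` rewards, rounded up, with error at most `1 /
(iota s + 1)` (`decode_bounds`). Packets are short, so `s ≤ 2 * eta s`, and in fact `eta s` differs
from `s` only by a logarithmic amount (`le_two_mul_eta`, `le_eta_of_le`).

Because the rounding is upward, quantization never lowers the index of the best arm, and the UCB1
argument survives with one extra error term. Let `ε` be a fraction of the gap. Once a suboptimal arm
has been pulled so often that its bonus is at most `gap - 2ε` and its rounding error at most `ε`,
broadcasting it forces either an unquantized index of the best arm below its mean, or an empirical
mean of that arm exceeding its own mean by `ε` (`le_avg_of_arm_eq`). The first event has probability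
at most `t⁻²` by Hoeffding and a union bound over sample sizes. The second is charged to the pull
count, which is distinct at distinct broadcasts, and costs at most `1 / ε²` in total. All deviations
are thus taken at deterministic sample sizes, one arm at a time (`regret_le_sum`).

With `ε = gap / C` this gives a bound for every `C > 2` (`regret_le`). The choice `C = 4` yields the
first bound. In the second, the excess over the leading term is of order `log n / C` and the other
costs of order `C²`; these balance at `C` of order `(log n)^(1/3)`. The asymptotic forms are
elementary estimates of each summand. -/

theorem tau_zero : tau 0 = 0 := by simp [tau]

theorem clog_le_clog_add_one {m n : ℕ} (h : n ≤ 2 * m) : Nat.clog 2 n ≤ Nat.clog 2 m + 1 := by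
  rw [Nat.clog_le_iff_le_pow (by norm_num), pow_succ]
  have := Nat.le_pow_clog (b := 2) (by norm_num) m
  omega

/-- The closed formula for `tau` is the sum of the packet lengths. -/
theorem tau_succ (i : ℕ) : tau (i + 1) = tau i + Nat.clog 2 (i + 2) := by
  have h1 := two_pow_clog_le i
  have h2 := two_pow_clog_le (i + 1)
  have hle : Nat.clog 2 (i + 1) ≤ Nat.clog 2 (i + 2) := Nat.clog_mono_right 2 (by omega)
  have hle' : Nat.clog 2 (i + 2) ≤ Nat.clog 2 (i + 1) + 1 := clog_le_clog_add_one (by omega)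
  have h3 := Nat.le_pow_clog (b := 2) (by norm_num) (i + 1)
  have h4 := Nat.le_pow_clog (b := 2) (by norm_num) (i + 2)
  unfold tau
  rw [show i + 1 + 1 = i + 2 by ring] at *
  rcases hle.eq_or_lt with h | h
  · rw [← h] at h2 ⊢
    have : (i + 2) * Nat.clog 2 (i + 1) = (i + 1) * Nat.clog 2 (i + 1) + Nat.clog 2 (i + 1) := by
      ring
    omega
  -- The logarithm jumps only when `i + 1` is a power of two.
  · have h5 : Nat.clog 2 (i + 2) = Nat.clog 2 (i + 1) + 1 := by omega
    have h6 : 2 ^ Nat.clog 2 (i + 1) < i + 2 := by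
      by_contra! hc
      have := (Nat.clog_le_iff_le_pow (b := 2) (by norm_num)).2 hc
      omega
    have h7 : 2 ^ Nat.clog 2 (i + 1) = i + 1 := by omega
    rw [h5] at h2 ⊢
    rw [pow_succ, h7] at *
    have : (i + 2) * (Nat.clog 2 (i + 1) + 1)
        = (i + 1) * Nat.clog 2 (i + 1) + Nat.clog 2 (i + 1) + (i + 2) := by
      ring
    omega

theorem one_le_clog (i : ℕ) : 1 ≤ Nat.clog 2 (i + 2) := Nat.clog_pos (by norm_num) (by omega)

theorem tau_strictMono : StrictMono tau :=
  strictMono_nat_of_lt_succ fun i => by rw [tau_succ]; have := one_le_clog i; omega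

theorem tau_iota_le (s : ℕ) : tau (iota s) ≤ s := (isGreatest_iota s).1

theorem lt_tau_iota_succ (s : ℕ) : s < tau (iota s + 1) := by
  by_contra! h
  have := (isGreatest_iota s).2 h
  omega

theorem le_iota_iff {i s : ℕ} : i ≤ iota s ↔ tau i ≤ s :=
  ⟨fun h => (tau_strictMono.monotone h).trans (tau_iota_le s), fun h => (isGreatest_iota s).2 h⟩

theorem iota_eq_iff {i s : ℕ} (h1 : tau i ≤ s) (h2 : s < tau (i + 1)) : iota s = i := by
  have h3 := le_iota_iff.2 h1
  have h4 : ¬ i + 1 ≤ iota s := fun h => by have := le_iota_iff.1 h; omega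
  omega

theorem one_le_iota {s : ℕ} (hs : 1 ≤ s) : 1 ≤ iota s := by
  have h1 : Nat.clog 2 2 ≤ 1 := (Nat.clog_le_iff_le_pow (by norm_num)).2 (by norm_num)
  have h2 := tau_succ 0
  rw [tau_zero] at h2
  simp only [zero_add] at h2
  exact le_iota_iff.2 (by omega)

theorem exists_iota_eq_succ {s : ℕ} (hs : 1 ≤ s) : ∃ j, iota s = j + 1 :=
  ⟨iota s - 1, by have := one_le_iota hs; omega⟩

theorem one_le_eta (s : ℕ) : 1 ≤ eta s := by unfold eta; omega

theorem eta_le {s : ℕ} (hs : 1 ≤ s) : eta s ≤ s := by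
  obtain ⟨j, hj⟩ := exists_iota_eq_succ hs
  have h := tau_iota_le s
  have := one_le_clog j
  rw [hj, tau_succ] at h
  simp only [eta, hj, Nat.add_sub_cancel]
  omega

/-- The delay of the estimate is bounded by two packets: the complete one that carries it and the
unfinished one after it. -/
theorem lt_eta_add {s j : ℕ} (hj : iota s = j + 1) :
    s + 1 < eta s + Nat.clog 2 (j + 2) + Nat.clog 2 (j + 3) := by
  have h := lt_tau_iota_succ s
  rw [hj, tau_succ, tau_succ, show j + 1 + 2 = j + 3 by ring] at h
  simp only [eta, hj, Nat.add_sub_cancel]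
  omega

theorem clog_add_clog_le (j : ℕ) :
    Nat.clog 2 (j + 2) + Nat.clog 2 (j + 3) ≤ 3 + tau j := by
  induction j with
  | zero =>
    have h1 : Nat.clog 2 2 ≤ 1 := (Nat.clog_le_iff_le_pow (by norm_num)).2 (by norm_num)
    have h2 : Nat.clog 2 3 ≤ 2 := (Nat.clog_le_iff_le_pow (by norm_num)).2 (by norm_num)
    simp only [zero_add]
    omega
  | succ j ih =>
    have h1 : Nat.clog 2 (j + 4) ≤ Nat.clog 2 (j + 2) + 1 := clog_le_clog_add_one (by omega)
    have := one_le_clog j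
    rw [tau_succ, show j + 1 + 2 = j + 3 by ring,
      show j + 1 + 3 = j + 4 by ring]
    omega

theorem le_two_mul_eta {s : ℕ} (hs : 1 ≤ s) : s ≤ 2 * eta s := by
  obtain ⟨j, hj⟩ := exists_iota_eq_succ hs
  have h1 := lt_eta_add hj
  have h2 := clog_add_clog_le j
  have h3 : eta s = 1 + tau j := by simp [eta, hj]
  omega

/-- If the estimate used fewer than `m` samples, the packet index would be below `m` too, so the two
packets causing the delay would have at most `Nat.clog 2 (m + 1)` bits each. -/
theorem le_eta_of_le {s m : ℕ} (hs : 1 ≤ s) (h : m + 2 * Nat.clog 2 (m + 1) ≤ s + 1) :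
    m ≤ eta s := by
  by_contra! hlt
  obtain ⟨j, hj⟩ := exists_iota_eq_succ hs
  have h1 := lt_eta_add hj
  have h3 : eta s = 1 + tau j := by simp [eta, hj]
  have h4 := le_tau j
  have h5 : Nat.clog 2 (j + 2) ≤ Nat.clog 2 (m + 1) := Nat.clog_mono_right 2 (by omega)
  have h6 : Nat.clog 2 (j + 3) ≤ Nat.clog 2 (m + 1) := Nat.clog_mono_right 2 (by omega)
  omega

/-- A crude bound, but enough: `s ≥ j ^ 2` pulls complete `j` packets and so control the
quantization error. -/
theorem tau_le_sq (j : ℕ) : tau j ≤ j ^ 2 := by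
  induction j with
  | zero => simp [tau_zero]
  | succ j ih =>
    have : Nat.clog 2 (j + 2) ≤ j + 1 := by
      rw [Nat.clog_le_iff_le_pow (by norm_num)]
      have := Nat.lt_two_pow_self (n := j + 1)
      omega
    rw [tau_succ]
    nlinarith

/-! ### Encoding and decoding of a packet -/

/-- The `j + 1`-st message of an arm with rewards `x`. -/
noncomputable def bit (x : ℕ → ℝ) (j : ℕ) : Bool := messagePolicy 0 ((List.range (j + 1)).map x)

/-- The average of the first `m` rewards. -/
noncomputable def avg (x : ℕ → ℝ) (m : ℕ) : ℝ := (∑ i ∈ Finset.range m, x i) / m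

theorem empMean_range_map (x : ℕ → ℝ) {m s : ℕ} (h : m ≤ s) :
    empMean ((List.range s).map x) m = avg x m := by
  unfold empMean avg
  rw [← List.map_take, List.take_range, min_eq_left h]
  rw [← List.sum_toFinset x List.nodup_range, List.toFinset_range]

theorem avg_mem_Icc {x : ℕ → ℝ} (hx : ∀ i, x i ∈ Set.Icc (0 : ℝ) 1) (m : ℕ) :
    avg x m ∈ Set.Icc (0 : ℝ) 1 := by
  refine ⟨div_nonneg (Finset.sum_nonneg fun i _ => (hx i).1) (Nat.cast_nonneg m), ?_⟩
  refine div_le_one_of_le₀ ?_ (Nat.cast_nonneg m)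
  simpa using Finset.sum_le_sum (s := Finset.range m) fun i _ => (hx i).2

theorem bit_toNat (x : ℕ → ℝ) {i j : ℕ} (h1 : tau i ≤ j) (h2 : j < tau (i + 1)) :
    ((bit x j).toNat : ℤ) = quantizer (j + 1 - tau i) (avg x (1 + tau i))
      - 2 * quantizer (j - tau i) (avg x (1 + tau i)) := by
  unfold bit
  rw [messagePolicy_toNat _ _ (by simp)]
  unfold messageValue
  simp only [List.length_map, List.length_range, Nat.add_sub_cancel, iota_eq_iff h1 h2]
  rw [empMean_range_map _ (by omega), show j + 1 - tau i - 1 = j - tau i by omega]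

/-- Starting value of the telescoping sum in a packet. The convention `⌈·⌉ - 1` makes it vanish at
`y = 1` as well. -/
theorem quantizer_zero {y : ℝ} (hy : y ∈ Set.Icc (0 : ℝ) 1) : quantizer 0 y = 0 := by
  unfold quantizer
  split_ifs with h
  · rfl
  · have h0 : 0 < y := lt_of_le_of_ne hy.1 (Ne.symm h)
    have : ⌈y⌉ = 1 := Int.ceil_eq_iff.2 ⟨by simpa using h0, by simpa using hy.2⟩
    simp [this]

theorem quantizer_bounds (y : ℝ) (α : ℕ) :
    2 ^ α * y ≤ (quantizer α y : ℝ) + 1 ∧ (quantizer α y : ℝ) ≤ 2 ^ α * y := by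
  unfold quantizer
  split_ifs with h
  · simp [h]
  · push_cast
    constructor
    · linarith [Int.le_ceil ((2 : ℝ) ^ α * y)]
    · linarith [Int.ceil_lt_add_one ((2 : ℝ) ^ α * y)]

/-- With weight `2 ^ (-i)`, where `i` is the position in the packet, the digit `q i - 2 q (i - 1)`
is a difference of consecutive values of `q i / 2 ^ i`, so the sum telescopes. -/
theorem sum_packet (f : ℕ → ℝ) (q : ℕ → ℝ) (a L : ℕ)
    (h : ∀ j, a ≤ j → j < a + L → f j = q (j + 1 - a) - 2 * q (j - a)) :
    ∑ s ∈ Finset.Icc (1 + a) (a + L), (2 : ℝ) ^ ((a : ℤ) - (s : ℤ)) * f (s - 1)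
      = q L / 2 ^ L - q 0 := by
  induction L with
  | zero => simp
  | succ L ih =>
    rw [← add_assoc, Finset.sum_Icc_succ_top (by omega),
      ih fun j h1 h2 => h j h1 (by omega), Nat.add_sub_cancel, h (a + L) (by omega) (by omega),
      show a + L + 1 - a = L + 1 by omega, show a + L - a = L by omega]
    have : (2 : ℝ) ^ ((a : ℤ) - ((a + L + 1 : ℕ) : ℤ)) = ((2 : ℝ) ^ (L + 1))⁻¹ := by
      rw [← zpow_natCast, ← zpow_neg]
      congr 1
      push_cast
      ring
    rw [this, pow_succ]
    field_simp
    ring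

/-- The final term of `decode` turns the truncated binary expansion into a rounding up, so the error
is one-sided; its size is `2 ^ (-L)` for a packet of `L` bits. -/
theorem decode_bounds {x : ℕ → ℝ} (hx : ∀ i, x i ∈ Set.Icc (0 : ℝ) 1) {s : ℕ} (hs : 1 ≤ s) :
    avg x (eta s) ≤ decode ((List.range s).map (bit x)) ∧
    decode ((List.range s).map (bit x)) ≤ avg x (eta s) + 1 / (iota s + 1 : ℝ) := by
  obtain ⟨j, hj⟩ := exists_iota_eq_succ hs
  have hτ := tau_iota_le s
  rw [hj] at hτ
  have heta : eta s = 1 + tau j := by simp [eta, hj]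
  have hy := avg_mem_Icc hx (1 + tau j)
  set L := Nat.clog 2 (j + 2) with hL
  have hdec : decode ((List.range s).map (bit x))
      = (quantizer L (avg x (1 + tau j)) + 1) / 2 ^ L := by
    unfold decode
    simp only [List.length_map, List.length_range, hj, Nat.add_sub_cancel]
    rw [tau_succ, ← hL, Finset.sum_congr rfl (g := fun s' : ℕ =>
      (2 : ℝ) ^ ((tau j : ℤ) - (s' : ℤ)) * (fun i => ((bit x i).toNat : ℝ)) (s' - 1))]
    · rw [sum_packet (fun i => ((bit x i).toNat : ℝ)) (fun α => (quantizer α (avg x (1 + tau j)) : ℝ)), quantizer_zero hy]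
      · have : (2 : ℝ) ^ ((tau j : ℤ) - ((tau j + L : ℕ) : ℤ)) = ((2 : ℝ) ^ L)⁻¹ := by
          rw [← zpow_natCast, ← zpow_neg]
          congr 1
          push_cast
          ring
        rw [this]
        simp [add_div]
      · intro i h1 h2
        have := bit_toNat x h1 (by rw [tau_succ]; exact h2)
        exact_mod_cast this
    · intro s' hs'
      rw [tau_succ] at hτ
      rw [Finset.mem_Icc] at hs'
      have : s' - 1 < s := by omega
      simp [List.getD, this]
  obtain ⟨b1, b2⟩ := quantizer_bounds (avg x (1 + tau j)) L
  have hpos : (0 : ℝ) < 2 ^ L := by positivity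
  rw [hdec, heta]
  constructor
  · rw [le_div_iff₀ hpos]
    linarith
  · have h2 : ((j + 2 : ℕ) : ℝ) ≤ 2 ^ L := by
      exact_mod_cast Nat.le_pow_clog (b := 2) (by norm_num) (j + 2)
    push_cast at h2
    have h3 : 1 / (2 : ℝ) ^ L ≤ 1 / ((iota s : ℝ) + 1) := by
      rw [hj]
      push_cast
      exact one_div_le_one_div_of_le (by positivity) (by linarith)
    have h4 : (quantizer L (avg x (1 + tau j)) + 1) / 2 ^ L
        ≤ avg x (1 + tau j) + 1 / (2 : ℝ) ^ L := by
      have := div_le_iff₀ hpos |>.2 (by linarith :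
        (quantizer L (avg x (1 + tau j)) : ℝ) ≤ avg x (1 + tau j) * 2 ^ L)
      rw [add_div]
      linarith
    linarith

end OneBitBandit
namespace OneBitBandit

/-! ### The history of a play -/

section History

variable {K : ℕ} {πa : ArmPolicy K} {x : Fin K → ℕ → ℝ}

/-- The number of broadcasts of arm `k` up to time `t`. -/
noncomputable def pulls (πa : ArmPolicy K) (x : Fin K → ℕ → ℝ) (t : ℕ) (k : Fin K) : ℕ :=
  (messages πa messagePolicy x t k).length

/-- The history of an arm depends on the play only through its number of pulls. -/
theorem messages_eq_map_bit (t : ℕ) (k : Fin K) :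
    messages πa messagePolicy x t k = (List.range (pulls πa x t k)).map (bit (x k)) := by
  induction t generalizing k with
  | zero => simp [pulls, messages]
  | succ t ih =>
    by_cases hk : k = πa (t + 1) (messages πa messagePolicy x t)
    · subst hk
      simp only [pulls, messages, Function.update_self, List.length_append, List.length_singleton,
        List.range_succ, List.map_append, List.map_singleton]
      rw [← pulls, ← ih]
      congr 2
      simp only [bit, List.range_succ, List.map_append, List.map_singleton]
      -- `messagePolicy` ignores the time, so evaluating it at time `0` in `bit` is harmless.
      rfl
    · simp only [pulls, messages, Function.update_of_ne hk]
      exact ih k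

theorem pulls_zero (k : Fin K) : pulls πa x 0 k = 0 := rfl

theorem pulls_succ (t : ℕ) (k : Fin K) :
    pulls πa x (t + 1) k
      = pulls πa x t k + if arm πa messagePolicy x (t + 1) = k then 1 else 0 := by
  simp only [pulls, messages, arm, Nat.add_sub_cancel]
  split_ifs with h
  · subst h
    simp
  · rw [Function.update_of_ne (Ne.symm h)]
    rfl

theorem pulls_mono (k : Fin K) : Monotone fun t => pulls πa x t k :=
  monotone_nat_of_le_succ fun t => by simp [pulls_succ]

theorem pulls_le (t : ℕ) (k : Fin K) : pulls πa x t k ≤ t := by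
  induction t with
  | zero => simp [pulls_zero]
  | succ t ih => rw [pulls_succ]; split_ifs <;> omega

theorem pulls_pred_lt {t u : ℕ} (ht : 1 ≤ t) (h : t < u) {k : Fin K}
    (hk : arm πa messagePolicy x t = k) : pulls πa x (t - 1) k < pulls πa x (u - 1) k := by
  obtain ⟨t, rfl⟩ : ∃ s, t = s + 1 := ⟨t - 1, by omega⟩
  have h1 := pulls_succ (πa := πa) (x := x) t k
  rw [if_pos hk] at h1
  have h2 : pulls πa x (t + 1) k ≤ pulls πa x (u - 1) k := pulls_mono k (by omega)
  simp only [Nat.add_sub_cancel]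
  omega

theorem injOn_pulls_pred (k : Fin K) :
    Set.InjOn (fun t => pulls πa x (t - 1) k) {t | 1 ≤ t ∧ arm πa messagePolicy x t = k} := by
  intro t ht u hu h
  rcases lt_trichotomy t u with h1 | h1 | h1
  · have := pulls_pred_lt ht.1 h1 ht.2
    simp only at h
    omega
  · exact h1
  · have := pulls_pred_lt hu.1 h1 hu.2
    simp only at h
    omega

/-- Some UCB index of an arm with rewards `y` is below `μ₀` at time `t`. -/
def IndexBelow (y : ℕ → ℝ) (μ₀ : ℝ) (t : ℕ) : Prop :=
  ∃ j ∈ Finset.Icc 1 t, avg y j + √(2 * Real.log t / j) < μ₀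

variable [NeZero K]

theorem one_le_pulls_zero {g : ℕ → ℝ → ℕ → ℝ} (hπ : IsArmPolicy g πa) {t : ℕ} (ht : 1 ≤ t) :
    1 ≤ pulls πa x t 0 := by
  have h1 : arm πa messagePolicy x (0 + 1) = 0 := by
    have := hπ.round_robin 1 (messages πa messagePolicy x 0) le_rfl
      (Nat.one_le_iff_ne_zero.2 (NeZero.ne K))
    exact Fin.ext (by simpa [arm] using this)
  have h2 := pulls_succ (πa := πa) (x := x) 0 0
  rw [if_pos h1] at h2
  have h3 : pulls πa x (0 + 1) 0 ≤ pulls πa x t 0 := pulls_mono 0 (by omega)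
  omega

/-- If UCB1 broadcasts arm `k` after the initial round, and neither the exploration bonus nor the
quantization error of `k` is large, then the index of the best arm is below its mean or the
empirical mean of arm `k` is too large. -/
theorem le_avg_of_arm_eq (hπ : IsArmPolicy gUCB1 πa) (hx : ∀ k i, x k i ∈ Set.Icc (0 : ℝ) 1)
    {t n : ℕ} (htK : K < t) (htn : t ≤ n) {k : Fin K} (hk : arm πa messagePolicy x t = k)
    {δ ε μ₀ : ℝ} (hs : 1 ≤ pulls πa x (t - 1) k)
    (h1 : √(2 * Real.log n / eta (pulls πa x (t - 1) k)) ≤ δ)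
    (h2 : 1 / (iota (pulls πa x (t - 1) k) + 1 : ℝ) ≤ ε)
    (hbest : ∀ j ∈ Finset.Icc 1 t, μ₀ ≤ avg (x 0) j + √(2 * Real.log t / j)) :
    μ₀ - δ - ε ≤ avg (x k) (eta (pulls πa x (t - 1) k)) := by
  have ht : 1 ≤ t - 1 := by have := NeZero.ne K; omega
  have hp0 := one_le_pulls_zero (x := x) hπ ht
  have hp0' := pulls_le (πa := πa) (x := x) (t - 1) 0
  have he0 := eta_le hp0
  have hmax := hπ.argmax t (messages πa messagePolicy x (t - 1)) htK 0
  have hk' : πa t (messages πa messagePolicy x (t - 1)) = k := hk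
  rw [hk', messages_eq_map_bit, messages_eq_map_bit] at hmax
  simp only [gUCB1, List.length_map, List.length_range] at hmax
  have hd0 := (decode_bounds (hx 0) hp0).1
  have hdk := (decode_bounds (hx k) hs).2
  -- The sample size of the best arm depends on the play; this is why `hbest` covers all sizes up to
  -- `t`.
  have hb := hbest (eta (pulls πa x (t - 1) 0))
    (Finset.mem_Icc.2 ⟨one_le_eta _, by omega⟩)
  have hlog : √(2 * Real.log t / eta (pulls πa x (t - 1) k))
      ≤ √(2 * Real.log n / eta (pulls πa x (t - 1) k)) := by
    apply Real.sqrt_le_sqrt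
    have : Real.log t ≤ Real.log n :=
      Real.log_le_log (by exact_mod_cast (by omega : 0 < t)) (by exact_mod_cast htn)
    gcongr
  linarith

open Classical in
-- Each broadcast of `k` is in the initial round, among its first `s₀` pulls, at a time when the
-- best arm is underestimated, or at a pull count where `k` is overestimated. Injectivity of the
-- pull count bounds the second and fourth classes.
theorem card_arm_eq_le (hπ : IsArmPolicy gUCB1 πa) (hx : ∀ k i, x k i ∈ Set.Icc (0 : ℝ) 1)
    (n : ℕ) (k : Fin K) {δ ε μ₀ : ℝ} {s₀ : ℕ} (hs₀ : 1 ≤ s₀)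
    (hδ : ∀ s, s₀ ≤ s → √(2 * Real.log n / eta s) ≤ δ)
    (hε : ∀ s, s₀ ≤ s → 1 / (iota s + 1 : ℝ) ≤ ε) :
    ((Finset.Icc 1 n).filter fun t => arm πa messagePolicy x t = k).card
      ≤ 1 + s₀
        + ((Finset.Icc 2 n).filter fun t => IndexBelow (x 0) μ₀ t).card
        + ((Finset.Ico 1 n).filter fun s => μ₀ - δ - ε ≤ avg (x k) (eta s)).card := by
  set S := (Finset.Icc 1 n).filter fun t => arm πa messagePolicy x t = k with hS
  set B := (Finset.Icc 2 n).filter fun t => IndexBelow (x 0) μ₀ t with hB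
  set D := (Finset.Ico 1 n).filter fun s => μ₀ - δ - ε ≤ avg (x k) (eta s) with hD
  have hinj : Set.InjOn (fun t => pulls πa x (t - 1) k) S := by
    refine (injOn_pulls_pred k).mono fun t ht => ?_
    simp only [hS, Finset.coe_filter, Finset.mem_Icc, Set.mem_ofPred_eq] at ht
    exact ⟨ht.1.1, ht.2⟩
  have hcover : S ⊆ {(k : ℕ) + 1} ∪ S.filter (fun t => pulls πa x (t - 1) k < s₀) ∪ B
      ∪ S.filter (fun t => pulls πa x (t - 1) k ∈ D) := by
    intro t ht
    have ht' := ht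
    simp only [hS, Finset.mem_filter, Finset.mem_Icc] at ht'
    obtain ⟨⟨ht1, htn⟩, hk⟩ := ht'
    simp only [Finset.mem_union, Finset.mem_singleton, Finset.mem_filter, ht, true_and]
    by_cases htK : t ≤ K
    · have := hπ.round_robin t (messages πa messagePolicy x (t - 1)) ht1 htK
      rw [show πa t (messages πa messagePolicy x (t - 1)) = k from hk] at this
      exact Or.inl (Or.inl (Or.inl this.symm))
    by_cases hlt : pulls πa x (t - 1) k < s₀
    · exact Or.inl (Or.inl (Or.inr hlt))
    by_cases hb : t ∈ B
    · exact Or.inl (Or.inr hb)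
    right
    have hK := NeZero.ne K
    have hp := pulls_le (πa := πa) (x := x) (t - 1) k
    push Not at htK hlt
    refine Finset.mem_filter.2 ⟨Finset.mem_Ico.2 ⟨by omega, by omega⟩, ?_⟩
    refine le_avg_of_arm_eq hπ hx htK htn hk (by omega) (hδ _ hlt) (hε _ hlt) fun j hj => ?_
    by_contra! hc
    exact hb (Finset.mem_filter.2 ⟨Finset.mem_Icc.2 ⟨by omega, htn⟩, j, hj, hc⟩)
  have h1 : (S.filter fun t => pulls πa x (t - 1) k < s₀).card ≤ s₀ := by
    rw [← Finset.card_range s₀]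
    refine Finset.card_le_card_of_injOn _ (fun t ht => ?_)
      (hinj.mono (Finset.coe_subset.2 (Finset.filter_subset _ _)))
    simpa using (Finset.mem_filter.1 ht).2
  have h2 : (S.filter fun t => pulls πa x (t - 1) k ∈ D).card ≤ D.card :=
    Finset.card_le_card_of_injOn _ (fun t ht => (Finset.mem_filter.1 ht).2)
      (hinj.mono (Finset.coe_subset.2 (Finset.filter_subset _ _)))
  refine (Finset.card_le_card hcover).trans ?_
  refine (Finset.card_union_le _ _).trans (add_le_add ?_ h2)
  refine (Finset.card_union_le _ _).trans (add_le_add ?_ le_rfl)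
  refine (Finset.card_union_le _ _).trans (add_le_add ?_ h1)
  simp

end History

end OneBitBandit
namespace OneBitBandit

/-! ### Measurability -/

theorem measurable_quantizer (α : ℕ) : Measurable (quantizer α) :=
  Measurable.ite (measurableSet_singleton 0) measurable_const
    ((Int.measurable_ceil.comp (measurable_const.mul measurable_id)).sub measurable_const)

theorem measurable_bit (j : ℕ) : Measurable fun x : ℕ → ℝ => bit x j := by
  have hb : tau (iota j) ≤ j := tau_iota_le j
  have h : Measurable fun x : ℕ → ℝ => messageValue ((List.range (j + 1)).map x) := by
    unfold messageValue
    simp only [List.length_map, List.length_range, Nat.add_sub_cancel]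
    have havg : Measurable fun x : ℕ → ℝ =>
        empMean ((List.range (j + 1)).map x) (1 + tau (iota j)) := by
      simp only [fun x : ℕ → ℝ => empMean_range_map x (by omega : 1 + tau (iota j) ≤ j + 1), avg]
      fun_prop
    exact ((measurable_quantizer _).comp havg).sub
      (measurable_const.mul ((measurable_quantizer _).comp havg))
  exact measurable_to_bool (by
    have : (fun x : ℕ → ℝ => bit x j) ⁻¹' {true}
        = (fun x : ℕ → ℝ => messageValue ((List.range (j + 1)).map x)) ⁻¹' {1} := by
      ext x
      simp [bit, messagePolicy]
    rw [this]
    exact h (measurableSet_singleton 1))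

theorem messages_succ {K : ℕ} (πa : ArmPolicy K) (x : Fin K → ℕ → ℝ) (t : ℕ) :
    messages πa messagePolicy x (t + 1)
      = Function.update (messages πa messagePolicy x t)
          (πa (t + 1) (messages πa messagePolicy x t))
          (messages πa messagePolicy x t (πa (t + 1) (messages πa messagePolicy x t)) ++
            [bit (x (πa (t + 1) (messages πa messagePolicy x t)))
              (messages πa messagePolicy x t
                (πa (t + 1) (messages πa messagePolicy x t))).length]) :=
  rfl

theorem measurable_arm {K : ℕ} (πa : ArmPolicy K) {Ω : Type*} [MeasurableSpace Ω]
    {X : Fin K → ℕ → Ω → ℝ} (hX : ∀ k i, Measurable (X k i)) (t : ℕ) :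
    Measurable fun ω => arm πa messagePolicy (fun k i => X k i ω) t := by
  -- There are only countably many histories, so the discrete σ-algebra works and measurability can
  -- be checked one history at a time.
  let _ : MeasurableSpace (Fin K → List Bool) := ⊤
  have : MeasurableSingletonClass (Fin K → List Bool) := ⟨fun _ => trivial⟩
  have hbit : ∀ k j, Measurable fun ω => bit (fun i => X k i ω) j := fun k j =>
    (measurable_bit j).comp (measurable_pi_iff.2 fun i => hX k i)
  have hm : ∀ t, Measurable fun ω => messages πa messagePolicy (fun k i => X k i ω) t := by
    intro t
    induction t with
    | zero => exact measurable_const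
    | succ t ih =>
      have hstep : ∀ h : Fin K → List Bool, Measurable fun ω =>
          Function.update h (πa (t + 1) h) (h (πa (t + 1) h) ++
            [bit (fun i => X (πa (t + 1) h) i ω) (h (πa (t + 1) h)).length]) := by
        intro h
        have : Measurable fun b : Bool =>
            Function.update h (πa (t + 1) h) (h (πa (t + 1) h) ++ [b]) := measurable_of_countable _
        exact this.comp (hbit (πa (t + 1) h) (h (πa (t + 1) h)).length)
      have hprod := measurable_from_prod_countable_right
        (f := fun p : (Fin K → List Bool) × Ω =>
          Function.update p.1 (πa (t + 1) p.1) (p.1 (πa (t + 1) p.1) ++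
            [bit (fun i => X (πa (t + 1) p.1) i p.2) (p.1 (πa (t + 1) p.1)).length])) hstep
      simp only [messages_succ]
      exact hprod.comp (ih.prodMk measurable_id)
  have : Measurable (πa t) := measurable_from_top
  exact this.comp (hm (t - 1))

/-! ### Concentration of the empirical means -/

section Concentration

variable {K : ℕ} {Ω : Type*} [MeasurableSpace Ω] {P : Measure Ω}
  {ν : Fin K → Measure ℝ} {X : Fin K → ℕ → Ω → ℝ}

theorem IsRewardModel.ae_mem_Icc (h : IsRewardModel P ν X) :
    ∀ᵐ ω ∂P, ∀ k i, X k i ω ∈ Set.Icc (0 : ℝ) 1 := by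
  rw [ae_all_iff]
  intro k
  rw [ae_all_iff]
  intro i
  have h1 : ∀ᵐ y ∂(P.map (X k i)), y ∈ Set.Icc (0 : ℝ) 1 := by
    rw [h.law]
    exact h.support k
  exact ae_of_ae_map (h.measurable k i).aemeasurable h1

theorem IsRewardModel.integral_eq (h : IsRewardModel P ν X) (k : Fin K) (i : ℕ) :
    ∫ ω, X k i ω ∂P = armMean ν k := by
  rw [armMean, ← h.law k i]
  exact (integral_map (h.measurable k i).aemeasurable aestronglyMeasurable_id).symm

theorem IsRewardModel.hasSubgaussianMGF [IsProbabilityMeasure P] (h : IsRewardModel P ν X) (k : Fin K) (i : ℕ) :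
    HasSubgaussianMGF (fun ω => X k i ω - armMean ν k) (1 / 4) P := by
  have h1 := hasSubgaussianMGF_of_mem_Icc (μ := P) (X := X k i) (a := 0) (b := 1)
    (h.measurable k i).aemeasurable (h.ae_mem_Icc.mono fun ω hω => hω k i)
  rw [h.integral_eq] at h1
  convert! h1 using 1
  norm_num

theorem sum_sub_const (x : ℕ → ℝ) (c : ℝ) {m : ℕ} (hm : 1 ≤ m) :
    ∑ i ∈ Finset.range m, (x i - c) = m * (avg x m - c) := by
  have : (m : ℝ) ≠ 0 := by positivity
  rw [Finset.sum_sub_distrib, avg]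
  simp
  field_simp

theorem IsRewardModel.measure_add_le_avg [IsProbabilityMeasure P] (h : IsRewardModel P ν X) (k : Fin K) {m : ℕ}
    (hm : 1 ≤ m) {ε : ℝ} (hε : 0 ≤ ε) :
    P.real {ω | armMean ν k + ε ≤ avg (fun i => X k i ω) m} ≤ Real.exp (-(2 * m * ε ^ 2)) := by
  have hm0 : (0 : ℝ) < m := by exact_mod_cast hm
  have hind : iIndepFun (fun i ω => X k i ω - armMean ν k) P :=
    (h.indep k).comp (fun _ y => y - armMean ν k) fun _ => by fun_prop
  have h1 := HasSubgaussianMGF.measure_sum_range_ge_le_of_iIndepFun hind (n := m)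
    (fun i _ => h.hasSubgaussianMGF k i) (ε := m * ε) (by positivity)
  have e1 : {ω | armMean ν k + ε ≤ avg (fun i => X k i ω) m}
      = {ω | m * ε ≤ ∑ i ∈ Finset.range m, (X k i ω - armMean ν k)} := by
    ext ω
    simp only [Set.mem_ofPred_eq, sum_sub_const (fun i => X k i ω) (armMean ν k) hm]
    rw [mul_le_mul_iff_right₀ hm0]
    constructor <;> intro <;> linarith
  rw [e1]
  refine h1.trans_eq ?_
  congr 1
  push_cast
  field_simp
  norm_num

theorem IsRewardModel.measure_avg_add_le [IsProbabilityMeasure P] (h : IsRewardModel P ν X) (k : Fin K) {m : ℕ}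
    (hm : 1 ≤ m) {ε : ℝ} (hε : 0 ≤ ε) :
    P.real {ω | avg (fun i => X k i ω) m + ε ≤ armMean ν k} ≤ Real.exp (-(2 * m * ε ^ 2)) := by
  have hm0 : (0 : ℝ) < m := by exact_mod_cast hm
  have hind : iIndepFun (fun i ω => -(X k i ω - armMean ν k)) P :=
    (h.indep k).comp (fun _ y => -(y - armMean ν k)) fun _ => by fun_prop
  have h1 := HasSubgaussianMGF.measure_sum_range_ge_le_of_iIndepFun hind (n := m)
    (fun i _ => (h.hasSubgaussianMGF k i).neg) (ε := m * ε) (by positivity)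
  have e1 : {ω | avg (fun i => X k i ω) m + ε ≤ armMean ν k}
      = {ω | m * ε ≤ ∑ i ∈ Finset.range m, -(X k i ω - armMean ν k)} := by
    ext ω
    simp only [Set.mem_ofPred_eq, Finset.sum_neg_distrib,
      sum_sub_const (fun i => X k i ω) (armMean ν k) hm]
    rw [← mul_neg, mul_le_mul_iff_right₀ hm0]
    constructor <;> intro <;> linarith
  rw [e1]
  refine h1.trans_eq ?_
  congr 1
  push_cast
  field_simp
  norm_num

theorem measurable_avg (hX : ∀ k i, Measurable (X k i)) (k : Fin K) (m : ℕ) :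
    Measurable fun ω => avg (fun i => X k i ω) m := by
  unfold avg
  fun_prop

variable [NeZero K]

theorem IsRewardModel.measure_index_lt [IsProbabilityMeasure P] (h : IsRewardModel P ν X) {t : ℕ} (ht : 2 ≤ t) :
    P.real {ω | IndexBelow (fun i => X 0 i ω) (armMean ν 0) t} ≤ ((t : ℝ) ^ 2)⁻¹ := by
  have ht0 : (2 : ℝ) ≤ t := by exact_mod_cast ht
  have hlog : 0 ≤ Real.log t := Real.log_nonneg (by linarith)
  have hsub : {ω | IndexBelow (fun i => X 0 i ω) (armMean ν 0) t}
      ⊆ ⋃ j ∈ Finset.Icc 1 t,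
        {ω | avg (fun i => X 0 i ω) j + √(2 * Real.log t / j) ≤ armMean ν 0} := by
    rintro ω ⟨j, hj, hlt⟩
    exact Set.mem_biUnion hj hlt.le
  calc _ ≤ P.real _ := measureReal_mono hsub (measure_ne_top _ _)
    _ ≤ ∑ j ∈ Finset.Icc 1 t,
        P.real {ω | avg (fun i => X 0 i ω) j + √(2 * Real.log t / j) ≤ armMean ν 0} :=
      measureReal_biUnion_finset_le _ _
    _ ≤ ∑ j ∈ Finset.Icc 1 t, ((t : ℝ) ^ 4)⁻¹ := by
      refine Finset.sum_le_sum fun j hj => ?_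
      have hj1 := (Finset.mem_Icc.1 hj).1
      have hj0 : (0 : ℝ) < j := by exact_mod_cast hj1
      -- The squared bonus makes the Hoeffding exponent `4 log t` whatever `j` is.
      refine (h.measure_avg_add_le 0 hj1 (Real.sqrt_nonneg _)).trans_eq ?_
      rw [Real.sq_sqrt (by positivity),
        show -(2 * (j : ℝ) * (2 * Real.log t / j)) = -(4 * Real.log t) by field_simp; ring,
        Real.exp_neg, ← Real.exp_log (by linarith : (0 : ℝ) < t), ← Real.exp_nat_mul]
      simp
    _ = t * ((t : ℝ) ^ 4)⁻¹ := by simp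
    _ ≤ ((t : ℝ) ^ 2)⁻¹ := by
      rw [← div_eq_mul_inv, div_le_iff₀ (by positivity), ← div_eq_inv_mul,
        le_div_iff₀ (by positivity)]
      nlinarith [pow_pos (by linarith : (0 : ℝ) < t) 2, pow_pos (by linarith : (0 : ℝ) < t) 3]

end Concentration

/-- A geometric series with ratio `r = exp (-y)`; `1 + y ≤ exp y` gives `r / (1 - r) ≤ 1 / y`. -/
theorem sum_exp_neg_le (n : ℕ) {y : ℝ} (hy : 0 < y) :
    ∑ s ∈ Finset.Ico 1 n, Real.exp (-(s * y)) ≤ 1 / y := by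
  set r := Real.exp (-y) with hr
  have hr0 : 0 < r := Real.exp_pos _
  have hr1 : r * (1 + y) ≤ 1 := by
    have h1 := Real.add_one_le_exp y
    have h2 : r * Real.exp y = 1 := by rw [hr, ← Real.exp_add]; simp
    nlinarith
  have hlt : 0 < 1 - r := by nlinarith
  have h1 : ∀ n : ℕ, ∑ s ∈ Finset.Ico 1 n, Real.exp (-(s * y)) = ∑ s ∈ Finset.Ico 1 n, r ^ s := by
    intro n
    refine Finset.sum_congr rfl fun s _ => ?_
    rw [hr, ← Real.exp_nat_mul]
    congr 1
    ring
  rw [h1, le_div_iff₀ hy]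
  rcases Nat.lt_or_ge n 1 with hn | hn
  · simp [Nat.lt_one_iff.1 hn]
  · rw [geom_sum_Ico' (by linarith) hn, div_mul_eq_mul_div, div_le_one hlt]
    have := pow_pos hr0 n
    nlinarith

end OneBitBandit
namespace OneBitBandit

/-! ### The regret bound -/

section Regret

variable {K : ℕ} [NeZero K]

theorem iSup_eq_of_sortedMeans {μ : Fin K → ℝ} (hμ : SortedMeans μ) : ⨆ k, μ k = μ 0 :=
  le_antisymm (ciSup_le fun k => hμ.antitone (Fin.zero_le k))
    (le_ciSup (Set.finite_range μ).bddAbove 0)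

theorem gap_pos {μ : Fin K → ℝ} (hμ : SortedMeans μ) {k : Fin K} (hk : k ∈ Finset.Ioi 0) :
    0 < gap μ k :=
  sub_pos.2 (hμ.unique_best k (Finset.mem_Ioi.1 hk).ne')

theorem gap_lt_one {μ : Fin K → ℝ} (hμ : SortedMeans μ) (k : Fin K) : gap μ k < 1 := by
  have h1 := hμ.lt_one 0
  have h2 := hμ.pos k
  unfold gap
  linarith

theorem sum_gap_eq (μ : Fin K → ℝ) (S : Finset ℕ) (a : ℕ → Fin K) :
    ∑ t ∈ S, gap μ (a t)
      = ∑ k ∈ Finset.Ioi (0 : Fin K), gap μ k * ((S.filter fun t => a t = k).card : ℝ) := by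
  rw [← Finset.sum_fiberwise S a]
  have h : ∀ k, ∑ t ∈ S with a t = k, gap μ (a t)
      = gap μ k * ((S.filter fun t => a t = k).card : ℝ) := by
    intro k
    rw [Finset.sum_congr rfl (g := fun _ => gap μ k)
      fun t ht => by rw [(Finset.mem_filter.1 ht).2]]
    simp [mul_comm]
  simp only [h]
  refine (Finset.sum_subset (Finset.subset_univ _) fun k _ hk => ?_).symm
  have : k = 0 := by simpa using hk
  simp [this, gap]

variable {Ω : Type*} [MeasurableSpace Ω] {P : Measure Ω} [IsProbabilityMeasure P]
  {ν : Fin K → Measure ℝ} {X : Fin K → ℕ → Ω → ℝ}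

omit [NeZero K] [IsProbabilityMeasure P] in
theorem measurableSet_indexBelow (hX : ∀ k i, Measurable (X k i)) (k : Fin K) (c : ℝ) (t : ℕ) :
    MeasurableSet {ω | IndexBelow (fun i => X k i ω) c t} := by
  have : {ω | IndexBelow (fun i => X k i ω) c t}
      = ⋃ j ∈ Finset.Icc 1 t, {ω | avg (fun i => X k i ω) j + √(2 * Real.log t / j) < c} := by
    ext ω
    simp [IndexBelow]
  rw [this]
  exact Finset.measurableSet_biUnion _ fun j _ =>
    measurableSet_lt ((measurable_avg hX k j).add measurable_const) measurable_const

theorem regret_le_sum (h : IsRewardModel P ν X) (hμ : SortedMeans (armMean ν))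
    {πa : ArmPolicy K} (hπ : IsArmPolicy gUCB1 πa) (n : ℕ) (s₀ : Fin K → ℕ) (ε : Fin K → ℝ)
    (hs₀ : ∀ k ∈ Finset.Ioi 0, 1 ≤ s₀ k) (hε : ∀ k ∈ Finset.Ioi 0, 0 < ε k)
    (hroot : ∀ k ∈ Finset.Ioi 0, ∀ s, s₀ k ≤ s →
      √(2 * Real.log n / eta s) ≤ gap (armMean ν) k - 2 * ε k)
    (hquant : ∀ k ∈ Finset.Ioi 0, ∀ s, s₀ k ≤ s → 1 / (iota s + 1 : ℝ) ≤ ε k) :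
    regret P ν X πa messagePolicy n
      ≤ ∑ k ∈ Finset.Ioi 0, gap (armMean ν) k * (2 + s₀ k + 1 / ε k ^ 2) := by
  classical
  set B : ℕ → Set Ω := fun t => {ω | IndexBelow (fun i => X 0 i ω) (armMean ν 0) t} with hB
  set D : Fin K → ℕ → Set Ω := fun k s =>
    {ω | armMean ν k + ε k ≤ avg (fun i => X k i ω) (eta s)} with hD
  have hBm : ∀ t, MeasurableSet (B t) := fun t => measurableSet_indexBelow h.measurable 0 _ t
  have hDm : ∀ k s, MeasurableSet (D k s) := fun k s =>
    measurableSet_le measurable_const (measurable_avg h.measurable k _)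
  have hBi : ∀ t, Integrable ((B t).indicator (1 : Ω → ℝ)) P := fun t =>
    (integrable_const (1 : ℝ)).indicator (hBm t)
  have hDi : ∀ k s, Integrable ((D k s).indicator (1 : Ω → ℝ)) P := fun k s =>
    (integrable_const (1 : ℝ)).indicator (hDm k s)
  have hBsum : Integrable (fun ω => ∑ t ∈ Finset.Icc 2 n, (B t).indicator (1 : Ω → ℝ) ω) P :=
    integrable_finsetSum _ fun t _ => hBi t
  have hDsum : ∀ k, Integrable
      (fun ω => ∑ s ∈ Finset.Ico 1 n, (D k s).indicator (1 : Ω → ℝ) ω) P := fun k =>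
    integrable_finsetSum _ fun s _ => hDi k s
  have hconst : ∀ k, Integrable (fun ω => 1 + (s₀ k : ℝ)
      + ∑ t ∈ Finset.Icc 2 n, (B t).indicator (1 : Ω → ℝ) ω) P := fun k =>
    (integrable_const _).add hBsum
  have hsumi : ∀ k, Integrable (fun ω => (1 + (s₀ k : ℝ)
      + ∑ t ∈ Finset.Icc 2 n, (B t).indicator (1 : Ω → ℝ) ω)
      + ∑ s ∈ Finset.Ico 1 n, (D k s).indicator (1 : Ω → ℝ) ω) P := fun k =>
    (hconst k).add (hDsum k)
  have hgapm : ∀ t, Integrable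
      (fun ω => gap (armMean ν) (arm πa messagePolicy (fun k i => X k i ω) t)) P := by
    intro t
    have hm : Measurable
        fun ω => gap (armMean ν) (arm πa messagePolicy (fun k i => X k i ω) t) :=
      (measurable_of_countable (gap (armMean ν))).comp (measurable_arm πa h.measurable t)
    refine Integrable.of_bound hm.aestronglyMeasurable 1 (Filter.Eventually.of_forall fun ω => ?_)
    rw [Real.norm_eq_abs, abs_le]
    refine ⟨?_, (gap_lt_one hμ _).le⟩
    have : 0 ≤ gap (armMean ν) (arm πa messagePolicy (fun k i => X k i ω) t) :=
      sub_nonneg.2 (hμ.antitone (Fin.zero_le _))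
    linarith
  have hreg : regret P ν X πa messagePolicy n
      = ∫ ω, ∑ t ∈ Finset.Icc 1 n,
          gap (armMean ν) (arm πa messagePolicy (fun k i => X k i ω) t) ∂P := by
    rw [integral_finsetSum _ fun t _ => hgapm t]
    unfold regret
    rw [iSup_eq_of_sortedMeans hμ]
    rfl
  have hpath : ∀ᵐ ω ∂P, ∑ t ∈ Finset.Icc 1 n,
        gap (armMean ν) (arm πa messagePolicy (fun k i => X k i ω) t)
      ≤ ∑ k ∈ Finset.Ioi 0, gap (armMean ν) k * ((1 + (s₀ k : ℝ)
          + ∑ t ∈ Finset.Icc 2 n, (B t).indicator (1 : Ω → ℝ) ω)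
          + ∑ s ∈ Finset.Ico 1 n, (D k s).indicator (1 : Ω → ℝ) ω) := by
    filter_upwards [h.ae_mem_Icc] with ω hω
    rw [sum_gap_eq]
    refine Finset.sum_le_sum fun k hk => mul_le_mul_of_nonneg_left ?_ (gap_pos hμ hk).le
    have hcard := card_arm_eq_le hπ hω n k (μ₀ := armMean ν 0) (hs₀ k hk) (hroot k hk)
      (hquant k hk)
    rw [show armMean ν 0 - (gap (armMean ν) k - 2 * ε k) - ε k = armMean ν k + ε k by
      unfold gap; ring] at hcard
    have e1 : ∑ t ∈ Finset.Icc 2 n, (B t).indicator (1 : Ω → ℝ) ω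
        = (((Finset.Icc 2 n).filter fun t =>
            IndexBelow (fun i => X 0 i ω) (armMean ν 0) t).card : ℝ) := by
      simp [Set.indicator_apply, hB]
    have e2 : ∑ s ∈ Finset.Ico 1 n, (D k s).indicator (1 : Ω → ℝ) ω
        = (((Finset.Ico 1 n).filter fun s =>
            armMean ν k + ε k ≤ avg (fun i => X k i ω) (eta s)).card : ℝ) := by
      simp [Set.indicator_apply, hD]
    rw [e1, e2]
    exact_mod_cast hcard
  rw [hreg]
  refine (integral_mono_ae (integrable_finsetSum _ fun t _ => hgapm t)
    (integrable_finsetSum _ fun k _ => (hsumi k).const_mul _) hpath).trans ?_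
  rw [integral_finsetSum _ fun k _ => (hsumi k).const_mul _]
  refine Finset.sum_le_sum fun k hk => ?_
  rw [integral_const_mul]
  refine mul_le_mul_of_nonneg_left ?_ (gap_pos hμ hk).le
  rw [integral_add (hconst k) (hDsum k), integral_add (integrable_const _) hBsum,
    integral_finsetSum _ fun t _ => hBi t, integral_finsetSum _ fun s _ => hDi k s]
  simp only [integral_indicator_one (hBm _), integral_indicator_one (hDm _ _)]
  -- This `1` and the one for the initial round make up the `2` of the statement.
  have hsB : ∑ t ∈ Finset.Icc 2 n, P.real (B t) ≤ 1 := by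
    have h1 : ∑ t ∈ Finset.Icc 2 n, P.real (B t) ≤ ∑ t ∈ Finset.Icc 2 n, ((t : ℝ) ^ 2)⁻¹ :=
      Finset.sum_le_sum fun t ht => h.measure_index_lt (Finset.mem_Icc.1 ht).1
    refine h1.trans ?_
    rcases Nat.lt_or_ge n 2 with hn | hn
    · simp [Finset.Icc_eq_empty_of_lt hn]
    · have h2 := sum_Ioc_inv_sq_le_sub (α := ℝ) (k := 1) (n := n) one_ne_zero (by omega)
      have h3 : (0 : ℝ) ≤ (n : ℝ)⁻¹ := by positivity
      have h4 : Finset.Icc 2 n = Finset.Ioc 1 n := by ext; simp; omega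
      rw [h4]
      simp only [Nat.cast_one, inv_one] at h2
      linarith
  have hsD : ∑ s ∈ Finset.Ico 1 n, P.real (D k s) ≤ 1 / ε k ^ 2 := by
    refine (Finset.sum_le_sum fun s hs => ?_).trans
      (sum_exp_neg_le n (pow_pos (hε k hk) 2))
    refine (h.measure_add_le_avg k (one_le_eta s) (hε k hk).le).trans ?_
    -- Replaces the Hoeffding exponent `2 * eta s * ε²` by `s * ε²`, leaving a geometric series in
    -- `s`.
    have h1 : (s : ℝ) ≤ 2 * eta s := by
      exact_mod_cast le_two_mul_eta (Finset.mem_Ico.1 hs).1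
    have h2 := mul_le_mul_of_nonneg_right h1 (pow_pos (hε k hk) 2).le
    exact Real.exp_le_exp.2 (by linarith)
  simp only [integral_const, probReal_univ, smul_eq_mul, one_mul]
  linarith

/-- The number of pulls after which both the exploration bonus at horizon `n` and the quantization
error are small relative to the gap `Δ`. -/
noncomputable def threshold (L Δ C : ℝ) : ℕ :=
  ⌈2 * L / (Δ ^ 2 * (1 - 2 / C) ^ 2)⌉₊
    + 2 * Nat.clog 2 (⌈2 * L / (Δ ^ 2 * (1 - 2 / C) ^ 2)⌉₊ + 1) + ⌊C / Δ⌋₊ ^ 2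

theorem one_sub_two_div_pos {C : ℝ} (hC : 2 < C) : 0 < 1 - 2 / C := by
  have : 2 / C < 1 := (div_lt_one (by linarith)).2 hC
  linarith

theorem one_le_threshold {L Δ C : ℝ} (hL : 0 < L) (hΔ : 0 < Δ) (hC : 2 < C) :
    1 ≤ threshold L Δ C := by
  have h := one_sub_two_div_pos hC
  have : 0 < ⌈2 * L / (Δ ^ 2 * (1 - 2 / C) ^ 2)⌉₊ := Nat.ceil_pos.2 (by positivity)
  unfold threshold
  omega

theorem sqrt_le_of_threshold_le {L Δ C : ℝ} (hL : 0 < L) (hΔ : 0 < Δ) (hC : 2 < C) {s : ℕ}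
    (hs : threshold L Δ C ≤ s) : √(2 * L / eta s) ≤ Δ - 2 * (Δ / C) := by
  have h := one_sub_two_div_pos hC
  have h1 := one_le_threshold hL hΔ hC
  have he : ⌈2 * L / (Δ ^ 2 * (1 - 2 / C) ^ 2)⌉₊ ≤ eta s := by
    refine le_eta_of_le (h1.trans hs) ?_
    unfold threshold at hs
    omega
  have he' := Nat.ceil_le.1 he
  have hpos : (0 : ℝ) < eta s := by exact_mod_cast one_le_eta s
  rw [show Δ - 2 * (Δ / C) = Δ * (1 - 2 / C) by ring]
  refine Real.sqrt_le_iff.2 ⟨by positivity, ?_⟩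
  rw [div_le_iff₀ (by positivity)] at he' ⊢
  linarith [mul_pow Δ (1 - 2 / C) 2]

theorem quantization_le_of_threshold_le {L Δ C : ℝ} (hΔ : 0 < Δ) (hC : 2 < C) {s : ℕ}
    (hs : threshold L Δ C ≤ s) : 1 / (iota s + 1 : ℝ) ≤ Δ / C := by
  have h1 : ⌊C / Δ⌋₊ ≤ iota s := by
    refine le_iota_iff.2 ((tau_le_sq _).trans ?_)
    unfold threshold at hs
    omega
  have h2 := Nat.lt_floor_add_one (C / Δ)
  have h3 : (⌊C / Δ⌋₊ : ℝ) ≤ iota s := by exact_mod_cast h1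
  have hpos : 0 < C / Δ := by positivity
  rw [← one_div_div C Δ]
  exact one_div_le_one_div_of_le hpos (by linarith)

theorem threshold_bound {L Δ C : ℝ} (hL : 0 < L) (hΔ : 0 < Δ) (hΔ1 : Δ < 1) (hC : 2 < C) :
    Δ * (2 + threshold L Δ C + 1 / (Δ / C) ^ 2)
      ≤ 2 * L / (Δ * (1 - 2 / C) ^ 2) + 10 * C ^ 2 / Δ + 19 * Δ / 6 *
        Real.logb 2 (max (⌈2 * L / (Δ ^ 2 * (1 - 2 / C) ^ 2)⌉ : ℝ) (4 * C ^ 2 / Δ ^ 2)) := by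
  have h := one_sub_two_div_pos hC
  set q := (1 - 2 / C) ^ 2 with hq
  have hq0 : 0 < q := by positivity
  set m₀ := 2 * L / (Δ ^ 2 * q) with hm₀
  have hm₀0 : 0 < m₀ := by positivity
  set M := max (⌈m₀⌉ : ℝ) (4 * C ^ 2 / Δ ^ 2) with hM
  set Q := C ^ 2 / Δ ^ 2 with hQ
  have hQ4 : 4 ≤ Q := by
    rw [hQ, le_div_iff₀ (by positivity)]
    nlinarith
  have hM1 : 1 ≤ M := by
    have : 4 * C ^ 2 / Δ ^ 2 = 4 * Q := by rw [hQ]; ring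
    have := le_max_right (⌈m₀⌉ : ℝ) (4 * C ^ 2 / Δ ^ 2)
    linarith
  have hlog0 : 0 ≤ Real.logb 2 M := Real.logb_nonneg (by norm_num) hM1
  set m := ⌈m₀⌉₊ with hm
  have hm1 : 1 ≤ m := Nat.ceil_pos.2 hm₀0
  have hmle : (m : ℝ) ≤ m₀ + 1 := (Nat.ceil_lt_add_one hm₀0.le).le
  have hmM : (m : ℝ) ≤ M := by
    have : (m : ℝ) = (⌈m₀⌉ : ℝ) := by rw [hm, natCast_ceil_eq_intCast_ceil hm₀0.le]
    rw [this]
    exact le_max_left _ _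
  -- By minimality of the ceiling logarithm, `2 ^ (clog - 1) < m + 1`, hence at most `m ≤ M`.
  have hclog : (Nat.clog 2 (m + 1) : ℝ) ≤ 1 + Real.logb 2 M := by
    obtain ⟨m', hm'⟩ : ∃ m', m = m' + 1 := ⟨m - 1, by omega⟩
    rw [hm'] at hmM ⊢
    have h1 := one_le_clog m'
    have h2 : 2 ^ (Nat.clog 2 (m' + 2)).pred < m' + 2 :=
      Nat.pow_pred_clog_lt_self (by norm_num) (by omega)
    have h3 : (2 : ℝ) ^ (Nat.clog 2 (m' + 2) - 1) ≤ M := by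
      refine le_trans ?_ hmM
      exact_mod_cast Nat.lt_succ_iff.1 h2
    have h4 : ((Nat.clog 2 (m' + 2) - 1 : ℕ) : ℝ) ≤ Real.logb 2 M := by
      rw [Real.le_logb_iff_rpow_le (by norm_num) (by linarith), Real.rpow_natCast]
      exact h3
    rw [Nat.cast_sub h1] at h4
    push_cast at h4
    linarith
  have hfloor : ((⌊C / Δ⌋₊ : ℝ)) ^ 2 ≤ Q := by
    rw [hQ, ← div_pow]
    exact pow_le_pow_left₀ (by positivity) (Nat.floor_le (by positivity)) 2
  have hinv : 1 / (Δ / C) ^ 2 = Q := by rw [hQ, div_pow, one_div_div]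
  have hthr : (threshold L Δ C : ℝ) ≤ m₀ + 3 + 2 * Real.logb 2 M + Q := by
    unfold threshold
    push_cast
    linarith
  have e1 : 2 * L / (Δ * q) = Δ * m₀ := by rw [hm₀]; field_simp
  have e2 : 10 * C ^ 2 / Δ = Δ * (10 * Q) := by rw [hQ]; field_simp
  rw [hinv, e1, e2]
  -- What arises is `m₀ + 5 + 2 * logb 2 M + 2 * Q`; the constants of the claim leave room.
  have : 2 + (threshold L Δ C : ℝ) + Q ≤ m₀ + 10 * Q + 19 / 6 * Real.logb 2 M := by linarith
  calc _ ≤ Δ * (m₀ + 10 * Q + 19 / 6 * Real.logb 2 M) := mul_le_mul_of_nonneg_left this hΔ.le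
    _ = _ := by ring

theorem regret_le (h : IsRewardModel P ν X) (hμ : SortedMeans (armMean ν))
    {πa : ArmPolicy K} (hπ : IsArmPolicy gUCB1 πa) {n : ℕ} (hn : 2 ≤ n) {C : ℝ} (hC : 2 < C) :
    regret P ν X πa messagePolicy n
      ≤ ∑ k ∈ Finset.Ioi 0,
        (2 * Real.log n / (gap (armMean ν) k * (1 - 2 / C) ^ 2) + 10 * C ^ 2 / gap (armMean ν) k
          + 19 * gap (armMean ν) k / 6 *
            Real.logb 2 (max
              (⌈2 * Real.log n / (gap (armMean ν) k ^ 2 * (1 - 2 / C) ^ 2)⌉ : ℝ)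
              (4 * C ^ 2 / gap (armMean ν) k ^ 2))) := by
  have hL : 0 < Real.log n := Real.log_pos (by exact_mod_cast hn)
  refine (regret_le_sum h hμ hπ n (fun k => threshold (Real.log n) (gap (armMean ν) k) C)
    (fun k => gap (armMean ν) k / C) (fun k hk => one_le_threshold hL (gap_pos hμ hk) hC)
    (fun k hk => div_pos (gap_pos hμ hk) (by linarith))
    (fun k hk s hs => sqrt_le_of_threshold_le hL (gap_pos hμ hk) hC hs)
    (fun k hk s hs => quantization_le_of_threshold_le (gap_pos hμ hk) hC hs)).trans ?_
  exact Finset.sum_le_sum fun k hk =>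
    threshold_bound hL (gap_pos hμ hk) (gap_lt_one hμ k) hC

theorem regret_le_bound₁ (h : IsRewardModel P ν X) (hμ : SortedMeans (armMean ν))
    {πa : ArmPolicy K} (hπ : IsArmPolicy gUCB1 πa) {n : ℕ} (hn : 2 ≤ n) :
    regret P ν X πa messagePolicy n ≤ bound₁ (armMean ν) n := by
  refine (regret_le h hμ hπ hn (C := 4) (by norm_num)).trans_eq ?_
  refine Finset.sum_congr rfl fun k hk => ?_
  have := (gap_pos hμ hk).ne'
  have e1 : 2 * Real.log n / (gap (armMean ν) k ^ 2 * (1 - 2 / 4) ^ 2)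
      = 8 * Real.log n / gap (armMean ν) k ^ 2 := by field_simp; ring
  have e2 : 2 * Real.log n / (gap (armMean ν) k * (1 - 2 / 4) ^ 2)
      = 8 * Real.log n / gap (armMean ν) k := by field_simp; ring
  rw [e1, e2]
  norm_num

theorem two_lt_Cn {n : ℕ} (hn : 2 ≤ n) : 2 < Cn n := by
  have hL : 0 < Real.log n := Real.log_pos (by exact_mod_cast hn)
  have := Real.rpow_pos_of_pos hL (1 / 3)
  unfold Cn
  linarith

theorem regret_le_bound₂ (h : IsRewardModel P ν X) (hμ : SortedMeans (armMean ν))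
    {πa : ArmPolicy K} (hπ : IsArmPolicy gUCB1 πa) {n : ℕ} (hn : 2 ≤ n) :
    regret P ν X πa messagePolicy n ≤ bound₂ (armMean ν) n := by
  have hC := two_lt_Cn hn
  refine (regret_le h hμ hπ hn hC).trans ?_
  refine Finset.sum_le_sum fun k hk => ?_
  have hΔ := gap_pos hμ hk
  have hq := one_sub_two_div_pos hC
  set Δ := gap (armMean ν) k
  set C := Cn n
  have hC0 : 0 < C := by linarith
  -- Splits `1 / (1 - 2/C)²` as `1 + 4 (1 - 1/C) / (C (1 - 2/C)²)`.
  have e1 : 2 * Real.log n / (Δ * (1 - 2 / C) ^ 2)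
      = 2 * Real.log n / Δ + 8 * (1 - 1 / C) * Real.log n / (Δ * (1 - 2 / C) ^ 2 * C) := by
    have e2 : 1 - 2 / C = (C - 2) / C := by field_simp
    have : C - 2 ≠ 0 := by linarith
    rw [e2]
    field_simp
    ring
  have hlog : 0 ≤ Real.logb 2
      (max (⌈2 * Real.log n / (Δ ^ 2 * (1 - 2 / C) ^ 2)⌉ : ℝ) (4 * C ^ 2 / Δ ^ 2)) := by
    refine Real.logb_nonneg (by norm_num) (le_max_of_le_right ?_)
    rw [le_div_iff₀ (by positivity)]
    have := gap_lt_one hμ k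
    nlinarith
  rw [e1]
  -- The coefficient `19/6` is weakened to the `13/4` of the second bound.
  have := mul_nonneg hΔ.le hlog
  linarith

end Regret

end OneBitBandit
namespace OneBitBandit

/-! ### The asymptotic form of the bounds -/

theorem gap_one_le {K : ℕ} [NeZero K] (hK : 2 ≤ K) {μ : Fin K → ℝ} (hμ : SortedMeans μ)
    {k : Fin K} (hk : k ∈ Finset.Ioi 0) : 0 < gap μ 1 ∧ gap μ 1 ≤ gap μ k := by
  obtain ⟨K, rfl⟩ : ∃ K', K = K' + 2 := ⟨K - 2, by omega⟩
  have hk0 : 0 < k := Finset.mem_Ioi.1 hk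
  have h1 : (1 : Fin (K + 2)) ≤ k := by
    rw [Fin.le_def, Fin.val_one]
    exact hk0
  have h0 : (1 : Fin (K + 2)) ≠ 0 := by
    intro h
    simpa using congrArg Fin.val h
  exact ⟨sub_pos.2 (hμ.unique_best 1 h0), sub_le_sub_left (hμ.antitone h1) _⟩

theorem abs_sum_sub_sum_le {K : ℕ} [NeZero K] (hK : 2 ≤ K) {μ : Fin K → ℝ} (hμ : SortedMeans μ)
    (F G : Fin K → ℝ) {c f : ℝ} (hc : 0 ≤ c * f)
    (hFG : ∀ k ∈ Finset.Ioi 0, |F k - G k| ≤ c * f / gap μ k) :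
    |∑ k ∈ Finset.Ioi 0, F k - ∑ k ∈ Finset.Ioi 0, G k| ≤ c * (K * f / gap μ 1) := by
  have h1mem : (1 : Fin K) ∈ Finset.Ioi 0 := by
    obtain ⟨K, rfl⟩ : ∃ K', K = K' + 2 := ⟨K - 2, by omega⟩
    simp
  have hg := (gap_one_le hK hμ h1mem).1
  rw [← Finset.sum_sub_distrib]
  calc _ ≤ ∑ k ∈ Finset.Ioi 0, |F k - G k| := Finset.abs_sum_le_sum_abs _ _
    _ ≤ ∑ _k ∈ Finset.Ioi (0 : Fin K), c * f / gap μ 1 := by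
      refine Finset.sum_le_sum fun k hk => (hFG k hk).trans ?_
      exact div_le_div_of_nonneg_left hc hg (gap_one_le hK hμ hk).2
    _ = ((Finset.Ioi (0 : Fin K)).card : ℝ) * (c * f / gap μ 1) := by simp
    _ ≤ K * (c * f / gap μ 1) := by
      refine mul_le_mul_of_nonneg_right ?_ (by positivity)
      have := Finset.card_le_univ (Finset.Ioi (0 : Fin K))
      rw [Fintype.card_fin] at this
      exact_mod_cast this
    _ = c * (K * f / gap μ 1) := by ring

/-- The gap inside the logarithm costs `log (1 / Δ ^ 2) ≤ 1 / Δ ^ 2`, and the prefactor `Δ` reduces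
this to order `1 / Δ`. The factor `2` absorbs `1 / log 2`. -/
theorem mul_logb_le {Δ y M : ℝ} (hΔ : 0 < Δ) (hΔ1 : Δ < 1) (hy : 1 ≤ y) (hM : 1 ≤ M)
    (hMy : M ≤ y / Δ ^ 2) : 0 ≤ Δ * Real.logb 2 M ∧
      Δ * Real.logb 2 M ≤ (2 * Real.log y + 2) / Δ := by
  have hlog2 := Real.log_two_gt_d9
  have hlogM : 0 ≤ Real.log M := Real.log_nonneg hM
  have hlogy : 0 ≤ Real.log y := Real.log_nonneg hy
  refine ⟨mul_nonneg hΔ.le (Real.logb_nonneg (by norm_num) hM), ?_⟩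
  have h1 : Real.log M ≤ Real.log y + 1 / Δ ^ 2 := by
    have hinv : 0 < 1 / Δ ^ 2 := by positivity
    have h2 := Real.log_le_log (by linarith) hMy
    rw [div_eq_mul_one_div, Real.log_mul (by linarith) hinv.ne'] at h2
    have := Real.log_le_sub_one_of_pos hinv
    linarith
  have h3 : Real.logb 2 M ≤ 2 * Real.log M := by
    rw [Real.logb, div_le_iff₀ (by linarith)]
    nlinarith
  rw [le_div_iff₀ hΔ]
  have h4 : Δ * Real.logb 2 M * Δ ≤ Δ ^ 2 * (2 * (Real.log y + 1 / Δ ^ 2)) := by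
    rw [show Δ * Real.logb 2 M * Δ = Δ ^ 2 * Real.logb 2 M by ring]
    exact mul_le_mul_of_nonneg_left (by linarith) (by positivity)
  have h5 : Δ ^ 2 * (2 * (Real.log y + 1 / Δ ^ 2)) = 2 * (Δ ^ 2 * Real.log y) + 2 := by
    field_simp
  have h6 : Δ ^ 2 ≤ 1 := by nlinarith
  nlinarith

theorem ceil_max_bounds {a b : ℝ} (hb : 1 ≤ b) :
    1 ≤ max (⌈a⌉ : ℝ) b ∧ max (⌈a⌉ : ℝ) b ≤ max (a + 1) b :=
  ⟨le_max_of_le_right hb, max_le_max (Int.ceil_lt_add_one a).le le_rfl⟩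

theorem bound₁_term_le {Δ L : ℝ} (hΔ : 0 < Δ) (hΔ1 : Δ < 1) (hL : 1 ≤ L) :
    |(8 * L / Δ + 160 / Δ + 19 * Δ / 6 *
        Real.logb 2 (max (⌈8 * L / Δ ^ 2⌉ : ℝ) (64 / Δ ^ 2))) - 8 * L / Δ|
      ≤ (230 + 7 * Real.log L) / Δ := by
  have hsq : 0 < Δ ^ 2 := by positivity
  have hsq1 : Δ ^ 2 ≤ 1 := by nlinarith
  have h64 : 1 ≤ 64 / Δ ^ 2 := by rw [le_div_iff₀ hsq]; linarith
  obtain ⟨hM1, hM2⟩ := ceil_max_bounds (a := 8 * L / Δ ^ 2) h64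
  have hMy : max (⌈8 * L / Δ ^ 2⌉ : ℝ) (64 / Δ ^ 2) ≤ (64 * L) / Δ ^ 2 := by
    refine hM2.trans (max_le ?_ ?_)
    · rw [div_add_one hsq.ne']
      gcongr
      linarith
    · gcongr
      linarith
  obtain ⟨h1, h2⟩ := mul_logb_le hΔ hΔ1 (by linarith) hM1 hMy
  rw [Real.log_mul (by norm_num) (by linarith)] at h2
  have h64' : Real.log 64 ≤ 6 := by
    rw [show (64 : ℝ) = 2 ^ 6 by norm_num, Real.log_pow]
    have := Real.log_two_lt_d9
    push_cast
    linarith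
  have hlogL : 0 ≤ Real.log L := Real.log_nonneg hL
  have h3 : (2 * (Real.log 64 + Real.log L) + 2) / Δ ≤ (14 + 2 * Real.log L) / Δ := by
    exact div_le_div_of_nonneg_right (by linarith) hΔ.le
  have h4 : (230 + 7 * Real.log L) / Δ = 160 / Δ + 19 / 6 * ((14 + 2 * Real.log L) / Δ)
      + (77 / 3 + 2 / 3 * Real.log L) / Δ := by ring
  have h5 : 0 ≤ (77 / 3 + 2 / 3 * Real.log L) / Δ := by positivity
  have h6 : 0 ≤ 160 / Δ := by positivity
  rw [abs_le, h4]
  constructor <;> linarith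

/-- Here `u` stands for `(log n)^(1/3)`, so `C = 2 + u` and `1 - 2/C = u / (2 + u)`; everything but
the logarithm becomes polynomial in `u`. As `u ≥ 1/2`, lower powers are absorbed into `u ^ 2`. -/
theorem bound₂_term_le {Δ u : ℝ} (hΔ : 0 < Δ) (hΔ1 : Δ < 1) (hu : 1 / 2 ≤ u) :
    |(2 * u ^ 3 / Δ
        + 8 * (1 - 1 / (2 + u)) * u ^ 3 / (Δ * (1 - 2 / (2 + u)) ^ 2 * (2 + u))
        + 10 * (2 + u) ^ 2 / Δ
        + 13 * Δ / 4 * Real.logb 2 (max (⌈2 * u ^ 3 / (Δ ^ 2 * (1 - 2 / (2 + u)) ^ 2)⌉ : ℝ)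
          (4 * (2 + u) ^ 2 / Δ ^ 2))) - 2 * u ^ 3 / Δ|
      ≤ 600 * u ^ 2 / Δ := by
  have hu0 : 0 < u := by linarith
  have hsq : 0 < Δ ^ 2 := by positivity
  have hsq1 : Δ ^ 2 ≤ 1 := by nlinarith
  have e0 : 1 - 2 / (2 + u) = u / (2 + u) := by field_simp; ring
  have e1 : 8 * (1 - 1 / (2 + u)) * u ^ 3 / (Δ * (1 - 2 / (2 + u)) ^ 2 * (2 + u))
      = 8 * (1 + u) * u / Δ := by
    rw [e0, show 1 - 1 / (2 + u) = (1 + u) / (2 + u) by field_simp; ring]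
    field_simp
  have e2 : 2 * u ^ 3 / (Δ ^ 2 * (1 - 2 / (2 + u)) ^ 2) = 2 * u * (2 + u) ^ 2 / Δ ^ 2 := by
    rw [e0]
    field_simp
  rw [e1, e2]
  have hb : 1 ≤ 4 * (2 + u) ^ 2 / Δ ^ 2 := by rw [le_div_iff₀ hsq]; nlinarith
  obtain ⟨hM1, hM2⟩ := ceil_max_bounds (a := 2 * u * (2 + u) ^ 2 / Δ ^ 2) hb
  have hMy : max (⌈2 * u * (2 + u) ^ 2 / Δ ^ 2⌉ : ℝ) (4 * (2 + u) ^ 2 / Δ ^ 2)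
      ≤ (2 * (2 + u) ^ 3) / Δ ^ 2 := by
    refine hM2.trans (max_le ?_ ?_)
    · rw [div_add_one hsq.ne']
      gcongr
      nlinarith
    · refine div_le_div_of_nonneg_right ?_ hsq.le
      nlinarith [mul_nonneg hu0.le (sq_nonneg (2 + u))]
  obtain ⟨h1, h2⟩ := mul_logb_le hΔ hΔ1 (by nlinarith [pow_pos hu0 2, pow_pos hu0 3]) hM1 hMy
  rw [Real.log_mul (by norm_num) (by positivity), Real.log_pow] at h2
  have hlog2 := Real.log_two_lt_d9
  have hlogu := Real.log_le_sub_one_of_pos (by linarith : 0 < 2 + u)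
  have h3 : (2 * (Real.log 2 + (3 : ℕ) * Real.log (2 + u)) + 2) / Δ ≤ (10 + 6 * u) / Δ := by
    refine div_le_div_of_nonneg_right ?_ hΔ.le
    push_cast
    linarith
  have h4 : 600 * u ^ 2 / Δ = 8 * (1 + u) * u / Δ + 10 * (2 + u) ^ 2 / Δ
      + 13 / 4 * ((10 + 6 * u) / Δ) + (582 * u ^ 2 - 135 / 2 * u - 145 / 2) / Δ := by ring
  have h5 : 0 ≤ (582 * u ^ 2 - 135 / 2 * u - 145 / 2) / Δ := by
    refine div_nonneg ?_ hΔ.le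
    nlinarith
  have h6 : 0 ≤ 8 * (1 + u) * u / Δ := by positivity
  have h7 : 0 ≤ 10 * (2 + u) ^ 2 / Δ := by positivity
  rw [abs_le, h4]
  constructor <;> linarith

theorem one_lt_log_three : 1 < Real.log 3 := by
  rw [Real.lt_log_iff_exp_lt (by norm_num)]
  exact Real.exp_one_lt_d9.trans (by norm_num)

theorem abs_bound₁_sub_le {K : ℕ} [NeZero K] (hK : 2 ≤ K) {μ : Fin K → ℝ} (hμ : SortedMeans μ)
    {n : ℕ} (hn : 3 ≤ n) :
    |bound₁ μ n - ∑ k ∈ Finset.Ioi (0 : Fin K), 8 * Real.log n / gap μ k|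
      ≤ (230 / Real.log (Real.log 3) + 7) * (K * Real.log (Real.log n) / gap μ 1) := by
  have h3 := one_lt_log_three
  have hc : 0 < Real.log (Real.log 3) := Real.log_pos h3
  have hn3 : Real.log 3 ≤ Real.log n := Real.log_le_log (by norm_num) (by exact_mod_cast hn)
  have hll : Real.log (Real.log 3) ≤ Real.log (Real.log n) :=
    Real.log_le_log (by linarith) hn3
  have hll0 : 0 < Real.log (Real.log n) := hc.trans_le hll
  refine abs_sum_sub_sum_le hK hμ _ _ (by positivity) fun k hk => ?_
  have hΔ := gap_pos hμ hk
  refine (bound₁_term_le hΔ (gap_lt_one hμ k) (by linarith)).trans ?_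
  gcongr
  -- The additive constant is absorbed since `log (log n)` is bounded below by `log (log 3) > 0`.
  have : 230 ≤ 230 / Real.log (Real.log 3) * Real.log (Real.log n) := by
    rw [div_mul_eq_mul_div, le_div_iff₀ hc]
    linarith
  linarith

theorem abs_bound₂_sub_le {K : ℕ} [NeZero K] (hK : 2 ≤ K) {μ : Fin K → ℝ} (hμ : SortedMeans μ)
    {n : ℕ} (hn : 2 ≤ n) :
    |bound₂ μ n - ∑ k ∈ Finset.Ioi (0 : Fin K), 2 * Real.log n / gap μ k|
      ≤ 600 * (K * Real.log n ^ (2 / 3 : ℝ) / gap μ 1) := by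
  have hL : Real.log 2 ≤ Real.log n := Real.log_le_log (by norm_num) (by exact_mod_cast hn)
  have hlog2 := Real.log_two_gt_d9
  have hL0 : 0 ≤ Real.log n := by linarith
  have hu3 : (Real.log n ^ (1 / 3 : ℝ)) ^ 3 = Real.log n := by
    rw [← Real.rpow_natCast, ← Real.rpow_mul hL0]
    norm_num
  have hu2 : Real.log n ^ (2 / 3 : ℝ) = (Real.log n ^ (1 / 3 : ℝ)) ^ 2 := by
    rw [← Real.rpow_natCast, ← Real.rpow_mul hL0]
    norm_num
  have hu0 : 0 ≤ Real.log n ^ (1 / 3 : ℝ) := Real.rpow_nonneg hL0 _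
  have hu : 1 / 2 ≤ Real.log n ^ (1 / 3 : ℝ) := by
    by_contra! h
    have := pow_le_pow_left₀ hu0 h.le 3
    rw [hu3] at this
    norm_num at this
    linarith
  rw [hu2]
  refine abs_sum_sub_sum_le hK hμ _ _ (by positivity) fun k hk => ?_
  have := bound₂_term_le (gap_pos hμ hk) (gap_lt_one hμ k) hu
  rw [hu3] at this
  exact this

end OneBitBandit

theorem corollary1 :
    -- the finite-horizon bound (for every `t`, the arm `A_t` is a random variable)
    (∀ (K : ℕ) [NeZero K], 2 ≤ K →
      ∀ (Ω : Type*) [MeasurableSpace Ω] (P : Measure Ω) [IsProbabilityMeasure P]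
        (ν : Fin K → Measure ℝ) (X : Fin K → ℕ → Ω → ℝ),
        IsRewardModel P ν X → SortedMeans (armMean ν) →
      ∀ πa : ArmPolicy K, IsArmPolicy gUCB1 πa →
        (∀ t, Measurable fun ω => arm πa messagePolicy (fun k i => X k i ω) t) ∧
        ∀ n : ℕ, 2 ≤ n →
          regret P ν X πa messagePolicy n
            ≤ min (bound₁ (armMean ν) n) (bound₂ (armMean ν) n)) ∧
    -- the asymptotic form of the two bounds, with a universal constant
    (∃ C : ℝ, 0 < C ∧ ∀ (K : ℕ) [NeZero K], 2 ≤ K →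
      ∀ μ : Fin K → ℝ, SortedMeans μ →
        (∀ n : ℕ, 3 ≤ n →
          |bound₁ μ n - ∑ k ∈ Finset.Ioi (0 : Fin K), 8 * Real.log n / gap μ k|
            ≤ C * (K * Real.log (Real.log n) / gap μ 1)) ∧
        (∀ n : ℕ, 2 ≤ n →
          |bound₂ μ n - ∑ k ∈ Finset.Ioi (0 : Fin K), 2 * Real.log n / gap μ k|
            ≤ C * (K * Real.log n ^ (2 / 3 : ℝ) / gap μ 1))) := by

  refine ⟨?_, ?_⟩
  · intro K _ _ Ω _ P _ ν X h hμ πa hπ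
    exact ⟨measurable_arm πa h.measurable,
      fun n hn => le_min (regret_le_bound₁ h hμ hπ hn) (regret_le_bound₂ h hμ hπ hn)⟩
  · have hc : 0 < 230 / Real.log (Real.log 3) + 7 := by
      have := Real.log_pos one_lt_log_three
      positivity
    refine ⟨230 / Real.log (Real.log 3) + 7 + 600, by linarith, fun K _ hK μ hμ => ?_⟩
    have hmono : ∀ {c f : ℝ}, 0 ≤ f → c ≤ 230 / Real.log (Real.log 3) + 7 + 600 →
        c * (K * f / gap μ 1)
          ≤ (230 / Real.log (Real.log 3) + 7 + 600) * (K * f / gap μ 1) := fun hf hc =>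
      mul_le_mul_of_nonneg_right hc
        (div_nonneg (by positivity) (sub_nonneg.2 (hμ.antitone (Fin.zero_le _))))
    refine ⟨fun n hn => (abs_bound₁_sub_le hK hμ hn).trans (hmono ?_ (by linarith)),
      fun n hn => (abs_bound₂_sub_le hK hμ hn).trans (hmono ?_ (by linarith))⟩
    · have hn3 : Real.log 3 ≤ Real.log n :=
        Real.log_le_log (by norm_num) (by exact_mod_cast hn)
      exact Real.log_nonneg (by linarith [one_lt_log_three])
    · exact Real.rpow_nonneg (Real.log_natCast_nonneg n) _
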